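/- **Setting.** Let $(\Omega,\mathcal F)$ be a measurable space, $\mathcal M$ the space of finite signed measures on it, $\mathcal M^1\subseteq\mathcal M$ the probability measures, and write $\mu(g)=\int g\,d\mu$. Let $\phi:\mathbb R\to\mathbb R\cup\{+\infty\}$ be convex and lower semicontinuous with $\phi(1)=0$ and finite on a neighbourhood of $1$. Put $\phi'(\pm\infty)=\lim_{x\to\pm\infty}\phi(x)/x\in[-\infty,+\infty]$, let $\phi_+$ equal $\phi$ on $[0,\infty)$ and $+\infty$ on $(-\infty,0)$, and let $\phi_+^\star(y)=\sup_{x\in\mathbb R}\{xy-\phi_+(x)\}$. For a finite nonnegative measure $\nu$ and $\mu\in\mathcal M$ with Lebesgue decomposition $\mu=\mu_c+\mu_s$ ($\mu_c\ll\nu$, $\mu_s\perp\nu$) and Hahn–Jordan decomposition $\mu_s=\mu_s^+-\mu_s^-$, the $\phi$-divergence is $$D_\phi(\mu\|\nu)=\int\phi\Big(\frac{d\mu_c}{d\nu}\Big)d\nu+\mu_s^+(\Omega)\,\phi'(\infty)-\mu_s^-(\Omega)\,\phi'(-\infty),\qquad 0\cdot(\pm\infty)=0.$$ Let $X\subseteq\mathcal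 M$ be a vector space and $\Xi=\{A\in\mathcal F:\ |\mu|(A)=0\text{ for all }\mu\in X\}$. Let $L^0(\Xi)$ be the space of real measurable functions modulo equality off a set of $\Xi$. The essential range of $g$ with respect to $\Xi$ is the set of $x\in\mathbb R$ such that $g^{-1}((x-\varepsilon,x+\varepsilon))\notin\Xi$ for all $\varepsilon>0$; $\operatorname{ess\,sup}_\Xi g$ is its supremum, and $L^\infty(\Xi)$ consists of the $g\in L^0(\Xi)$ with bounded essential range. For a vector space $Y$ of functions and a finite nonnegative measure $\nu\in X$, the pair $(X,Y)$ is *$\nu$-decomposable* if 1. $(\mu,g)\mapsto\mu(g)$ is a well-defined real-valued pairing that puts $X$ and $Y$ in separating duality; 2. $\{\mu\in\mathcal M:\ \mu\ll\nu,\ d\mu/d\nu\in L^\infty(\nu)\}\subseteq X$ and $L^\infty(\Xi)\subseteq Y\subseteq L^0(\Xi)$; 3. for every $A\in\mathcal F\setminus\Xi$ there is a nonzero nonnegative $\mu\in X$ with $\mu(\Omega\setminus A)=0$. A topology on $X$ is *compatible* with the pairing if it is a locally convex vector space topology whose continuous linear forms are exactly the maps $\mu\mapsto\mu(g)$, $g\in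 Y$ (for example the weak topology $\sigma(X,Y)$). **Corollary.** Let $\nu$ be a probability measure and let $(X,Y)$ be $\nu$-decomposable. Then the $\phi$-divergence restricted to probability measures, that is, the function on $X$ equal to $D_\phi(\mu\|\nu)$ if $\mu\in X\cap\mathcal M^1$ and to $+\infty$ otherwise, is lower semicontinuous on $X$ for every topology compatible with the pairing. Moreover, for every probability measure $\mu\in X$, $$D_\phi(\mu\|\nu)=\sup_{g\in Y}\Big\{\mu(g)-\inf\Big\{\int\phi_+^\star(g+\lambda)\,d\nu-\lambda\ :\ \lambda\in\mathbb R,\ \lambda+\operatorname{ess\,sup}_\Xi g\le\phi'(\infty)\Big\}\Big\},$$ where the infimum over the empty set is $+\infty$. -/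

import Mathlib

open MeasureTheory Filter Topology
open scoped ENNReal

namespace PhiDivergence

noncomputable section

/-! ### Convex functions on the real line with values in the extended reals -/

/-- Convexity of an extended-real-valued function on `ℝ` that never takes the value `-∞`. -/
def IsConvexFn (f : ℝ → EReal) : Prop :=
  ∀ x y a b : ℝ, 0 ≤ a → 0 ≤ b → a + b = 1 →
    f (a * x + b * y) ≤ (a : EReal) * f x + (b : EReal) * f y

/-- The convex conjugate `f*(y) = sup_x (x y - f x)`. -/
def conjugate (f : ℝ → EReal) (y : ℝ) : EReal :=
  ⨆ x : ℝ, ((x * y : ℝ) : EReal) - f x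

/-- `f'(∞) = lim_{x → +∞} f(x) / x`. For a proper convex function the limit exists in the
extended reals, hence equals the upper limit. -/
def slopeAtTop (f : ℝ → EReal) : EReal :=
  limsup (fun x : ℝ => f x / (x : EReal)) atTop

/-- `f'(-∞) = lim_{x → -∞} f(x) / x`. For a proper convex function the limit exists in the
extended reals, hence equals the upper limit. -/
def slopeAtBot (f : ℝ → EReal) : EReal :=
  limsup (fun x : ℝ => f x / (x : EReal)) atBot

/-- `φ₊ = φ + δ_{[0, ∞)}`: equal to `φ` on `[0, ∞)` and to `+∞` elsewhere. -/
def posRestrict (φ : ℝ → EReal) (x : ℝ) : EReal :=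
  if 0 ≤ x then φ x else ⊤

variable {Ω : Type*} [MeasurableSpace Ω]

/-! ### Integrals -/

/-- The integral of an extended-real-valued function against a nonnegative measure: the integral
of the positive part minus that of the negative part. Below it is only applied to functions
bounded from below by an integrable function, for which the second integral is finite. -/
def extIntegral (ν : Measure Ω) (f : Ω → EReal) : EReal :=
  ((∫⁻ ω, (f ω).toENNReal ∂ν : ℝ≥0∞) : EReal) - ((∫⁻ ω, (-f ω).toENNReal ∂ν : ℝ≥0∞) : EReal)

/-- The pairing `μ(g) = ∫ g dμ` of a finite signed measure and a real function. -/
def pairing (μ : SignedMeasure Ω) (g : Ω → ℝ) : ℝ :=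
  ∫ᵛ ω, g ω ∂<•μ

/-! ### The `φ`-divergence -/

/-- The `φ`-divergence of a finite signed measure `μ = μ_c + μ_s` with respect to `ν`:
`ν(φ(dμ_c/dν)) + μ_s⁺(Ω) φ'(∞) - μ_s⁻(Ω) φ'(-∞)`, with `0 · (±∞) = 0`. Here
`μ.rnDeriv ν` is the density of the absolutely continuous part `μ_c`, and `μ_s⁺`, `μ_s⁻` are the
Hahn–Jordan components of the singular part. -/
def divergence (φ : ℝ → EReal) (ν : Measure Ω) (μ : SignedMeasure Ω) : EReal :=
  extIntegral ν (fun ω => φ (μ.rnDeriv ν ω))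
    + (((μ.singularPart ν).toJordanDecomposition.posPart Set.univ : ℝ≥0∞) : EReal) * slopeAtTop φ
    - (((μ.singularPart ν).toJordanDecomposition.negPart Set.univ : ℝ≥0∞) : EReal) * slopeAtBot φ

/-- The set of probability measures, inside the space of finite signed measures. -/
def probMeasures (Ω : Type*) [MeasurableSpace Ω] : Set (SignedMeasure Ω) :=
  {μ | 0 ≤ μ ∧ μ Set.univ = 1}

open Classical in
/-- The `φ`-divergence restricted to probability measures: `+∞` off the probability measures. -/
def probDivergence (φ : ℝ → EReal) (ν : Measure Ω) (μ : SignedMeasure Ω) : EReal :=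
  if μ ∈ probMeasures Ω then divergence φ ν μ else ⊤

/-! ### The null ideal of a space of measures -/

/-- The `σ`-ideal `Ξ` of the measurable sets that are null for every measure in `X`. -/
def nullIdeal (X : Submodule ℝ (SignedMeasure Ω)) : Set (Set Ω) :=
  {A | MeasurableSet A ∧ ∀ μ ∈ X, μ.variation A = 0}

/-- The essential range of `g` with respect to an ideal `Ξ` of measurable sets. -/
def essRange (Ξ : Set (Set Ω)) (g : Ω → ℝ) : Set ℝ :=
  {x | ∀ ε > 0, g ⁻¹' Set.Ioo (x - ε) (x + ε) ∉ Ξ}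

/-- The essential supremum `esssup_Ξ g`, the supremum of the essential range. -/
def essSupIdeal (Ξ : Set (Set Ω)) (g : Ω → ℝ) : EReal :=
  ⨆ x ∈ essRange Ξ g, (x : EReal)

/-! ### Decomposable dual pairs -/

/-- `(X, Y)` is `ν`-decomposable, with `Ξ` the null ideal of `X`. A vector space `Y` with
`L^∞(Ξ) ⊆ Y ⊆ L⁰(Ξ)` of functions modulo equality off a set of `Ξ` is represented by the space of
all representatives of its elements. Thus `Y` consists of measurable functions and contains all
measurable functions with bounded `Ξ`-essential range, in particular all measurable functions that
vanish off a set of `Ξ`, and "`g = 0` in `L⁰(Ξ)`" reads `{ω | g ω ≠ 0} ∈ Ξ`. -/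
structure IsDecomposable (X : Submodule ℝ (SignedMeasure Ω)) (Y : Submodule ℝ (Ω → ℝ))
    (ν : Measure Ω) [IsFiniteMeasure ν] : Prop where
  /-- The reference measure belongs to `X`. -/
  mem : ν.toSignedMeasure ∈ X
  /-- The pairing `μ(g)` is defined on `X × Y`. -/
  integrable : ∀ μ ∈ X, ∀ g ∈ Y, μ.Integrable g
  /-- The pairing separates the points of `X`. -/
  separating_left : ∀ μ ∈ X, (∀ g ∈ Y, pairing μ g = 0) → μ = 0
  /-- The pairing separates the points of `Y`, modulo `Ξ`. -/
  separating_right : ∀ g ∈ Y, (∀ μ ∈ X, pairing μ g = 0) → {ω | g ω ≠ 0} ∈ nullIdeal X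
  /-- `X` contains the measures absolutely continuous with respect to `ν` with a density in
  `L^∞(ν)`. -/
  mem_of_density : ∀ μ : SignedMeasure Ω, μ ≪ᵥ ν.toENNRealVectorMeasure →
    MemLp (μ.rnDeriv ν) ∞ ν → μ ∈ X
  /-- `L^∞(Ξ) ⊆ Y`. -/
  mem_of_bounded : ∀ g : Ω → ℝ, Measurable g →
    Bornology.IsBounded (essRange (nullIdeal X) g) → g ∈ Y
  /-- `Y ⊆ L⁰(Ξ)`. -/
  measurable : ∀ g ∈ Y, Measurable g
  /-- Every measurable set outside `Ξ` carries a nonzero nonnegative measure of `X`. -/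
  exists_supported : ∀ A : Set Ω, MeasurableSet A → A ∉ nullIdeal X →
    ∃ μ ∈ X, 0 ≤ μ ∧ μ ≠ 0 ∧ μ Aᶜ = 0

/-- A topology on `X` is compatible with the pairing of `X` and `Y`: it is a locally convex vector
space topology whose continuous linear forms are exactly the forms `μ ↦ μ(g)` with `g ∈ Y`. -/
structure IsCompatibleTopology (X : Submodule ℝ (SignedMeasure Ω)) (Y : Submodule ℝ (Ω → ℝ))
    (τ : TopologicalSpace X) : Prop where
  isTopologicalAddGroup : IsTopologicalAddGroup X
  continuousSMul : ContinuousSMul ℝ X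
  locallyConvexSpace : LocallyConvexSpace ℝ X
  continuous_iff : ∀ ℓ : X →ₗ[ℝ] ℝ,
    Continuous ℓ ↔ ∃ g ∈ Y, ∀ μ : X, ℓ μ = pairing (μ : SignedMeasure Ω) g

end

end PhiDivergence

namespace PhiDivergence

/-! Everything follows from the variational formula: its right-hand side is a supremum of functions
of `μ` that are continuous in every compatible topology, and the probability measures form a closed
set because evaluation at a measurable set is pairing with an indicator.

The formula is proved by hand, without duality on `X`. Let `P` be the probability measure `μ`, with
`ν`-density `f`. For `≥` (`le_divergence_toSignedMeasure`), Fenchel–Young with `x = f` handles the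
absolutely continuous part, and the constraint on `g + t` bounds the singular part by its mass times
`φ'(∞)`.

For `≤` (`divergence_toSignedMeasure_le`), `φ` is the increasing limit of affine functions `x ↦ x *
y n x - c n x`, chosen measurably among finitely many minorants
(`exists_measurable_affineMinorants`). The test function equal to `y n ∘ f` where `ν` lives and to a
real `s ≤ φ'(∞)` where the singular part lives is bounded, hence in `Y`. It is at most `φ'(∞)`, so
the shift `0` is admissible, and its conjugate integral is at most `∫ c n ∘ f`. Monotone convergence
in `n`, then a choice of `s`, recovers the divergence. -/

/-! ### Affine minorants and their measurable selection -/

/-- The pair `(y, c)` encodes an affine minorant `x ↦ x y - c` of `f`. -/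
def affineMinorants (f : ℝ → EReal) : Set (ℝ × ℝ) :=
  {p | ∀ x : ℝ, ((x * p.1 - p.2 : ℝ) : EReal) ≤ f x}

lemma isClosed_epigraph_real {f : ℝ → EReal} (hf : LowerSemicontinuous f) :
    IsClosed {p : ℝ × ℝ | f p.1 ≤ (p.2 : EReal)} :=
  (lowerSemicontinuous_iff_isClosed_epigraph.1 hf).preimage
    (f := fun p : ℝ × ℝ => (p.1, (p.2 : EReal)))
    (continuous_fst.prodMk (continuous_coe_real_ereal.comp continuous_snd))

lemma IsConvexFn.convex_epigraph_real {f : ℝ → EReal} (hf : IsConvexFn f) :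
    Convex ℝ {p : ℝ × ℝ | f p.1 ≤ (p.2 : EReal)} := by
  rintro ⟨x, s⟩ hx ⟨y, t⟩ hy a b ha hb hab
  simp only [Set.mem_ofPred_eq] at hx hy
  simp only [Set.mem_ofPred_eq, Prod.smul_mk, Prod.mk_add_mk, smul_eq_mul]
  refine (hf x y a b ha hb hab).trans ?_
  rw [EReal.coe_add, EReal.coe_mul, EReal.coe_mul]
  exact add_le_add (mul_le_mul_of_nonneg_left hx (EReal.coe_nonneg.2 ha))
    (mul_le_mul_of_nonneg_left hy (EReal.coe_nonneg.2 hb))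

/-- A point strictly below the graph is separated from the epigraph by a line. -/
lemma exists_separating_line {f : ℝ → EReal} (hconv : IsConvexFn f)
    (hlsc : LowerSemicontinuous f) {x r : ℝ} (hr : (r : EReal) < f x) :
    ∃ a b u : ℝ, a * x + b * r < u ∧ ∀ z t : ℝ, f z ≤ (t : EReal) → u < a * z + b * t := by
  obtain ⟨F, u, h1, h2⟩ := geometric_hahn_banach_point_closed (x := ((x, r) : ℝ × ℝ))
    hconv.convex_epigraph_real (isClosed_epigraph_real hlsc) (by simpa using hr)
  have hF : ∀ z t : ℝ, F (z, t) = F (1, 0) * z + F (0, 1) * t := by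
    intro z t
    have : ((z, t) : ℝ × ℝ) = z • (1, 0) + t • (0, 1) := by simp
    rw [this, map_add, map_smul, map_smul]
    simp [mul_comm]
  exact ⟨F (1, 0), F (0, 1), u, by rw [← hF]; exact h1, fun z t h => by rw [← hF]; exact h2 _ h⟩

/-- A separating line with positive second coefficient yields an affine minorant. -/
lemma exists_affineMinorant_of_separating {f : ℝ → EReal} (hbot : ∀ z, f z ≠ ⊥) {x r a b u : ℝ}
    (h1 : a * x + b * r < u) (h2 : ∀ z t : ℝ, f z ≤ (t : EReal) → u < a * z + b * t)
    (hb : 0 < b) : ∃ p ∈ affineMinorants f, r < x * p.1 - p.2 := by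
  refine ⟨(-a / b, -u / b), fun z => ?_, ?_⟩
  · rcases eq_or_ne (f z) ⊤ with h | h
    · rw [h]; exact le_top
    · lift f z to ℝ using ⟨h, hbot z⟩ with t ht
      have := h2 z t ht.ge
      rw [EReal.coe_le_coe_iff]
      have e : z * (-a / b) - -u / b = (u - a * z) / b := by ring
      rw [e, div_le_iff₀ hb]
      nlinarith
  · have e : x * (-a / b) - -u / b = (u - a * x) / b := by ring
    simp only [e]
    rw [lt_div_iff₀ hb]
    nlinarith

/-- The epigraph is unbounded upwards, so a negative `b` would push `a * x₀ + b * t` below `u`. -/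
lemma nonneg_of_separating {f : ℝ → EReal} {x₀ t₀ a b u : ℝ} (h₀ : f x₀ ≤ (t₀ : EReal))
    (h2 : ∀ z t : ℝ, f z ≤ (t : EReal) → u < a * z + b * t) : 0 ≤ b := by
  by_contra! hb
  set t := max t₀ ((a * x₀ - u) / (-b)) with ht
  have h := h2 x₀ t (h₀.trans (EReal.coe_le_coe_iff.2 (le_max_left _ _)))
  have h' : (a * x₀ - u) / (-b) ≤ t := le_max_right _ _
  rw [div_le_iff₀ (by linarith)] at h'
  nlinarith

/-- A proper convex lower semicontinuous function is the supremum of its affine minorants. -/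
lemma exists_affineMinorant_gt {f : ℝ → EReal} (hbot : ∀ z, f z ≠ ⊥) (hconv : IsConvexFn f)
    (hlsc : LowerSemicontinuous f) {x₀ t₀ : ℝ} (h₀ : f x₀ = (t₀ : EReal)) {x r : ℝ}
    (hr : (r : EReal) < f x) : ∃ p ∈ affineMinorants f, r < x * p.1 - p.2 := by
  obtain ⟨a, b, u, h1, h2⟩ := exists_separating_line hconv hlsc hr
  rcases (nonneg_of_separating h₀.le h2).eq_or_lt with hb | hb
  -- Vertical line, so `f x = ⊤`: `u - a * z` is negative on the domain and positive at `x`. Adding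
  -- a large multiple `k` of it to any minorant gives another one, arbitrarily high at `x`.
  · obtain ⟨p, hp⟩ : ∃ p, p ∈ affineMinorants f := by
      have hr₀ : ((t₀ - 1 : ℝ) : EReal) < f x₀ := by
        rw [h₀, EReal.coe_lt_coe_iff]; linarith
      obtain ⟨a', b', u', h1', h2'⟩ := exists_separating_line hconv hlsc hr₀
      -- Over `x₀` the line separates heights `t₀ - 1` and `t₀`, so it is not vertical.
      have hb' : 0 < b' := by nlinarith [h2' x₀ t₀ h₀.le]
      obtain ⟨p, hp, -⟩ := exists_affineMinorant_of_separating hbot h1' h2' hb'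
      exact ⟨p, hp⟩
    subst hb
    have hpos : 0 < u - a * x := by linarith
    set k : ℝ := max 0 ((r - (x * p.1 - p.2) + 1) / (u - a * x)) with hk
    have hk0 : 0 ≤ k := le_max_left _ _
    have hk1 : (r - (x * p.1 - p.2) + 1) / (u - a * x) ≤ k := le_max_right _ _
    rw [div_le_iff₀ hpos] at hk1
    refine ⟨(p.1 - k * a, p.2 - k * u), fun z => ?_, ?_⟩
    · rcases eq_or_ne (f z) ⊤ with h | h
      · rw [h]; exact le_top
      · have hz := hp z
        lift f z to ℝ using ⟨h, hbot z⟩ with t ht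
        have := h2 z t ht.ge
        rw [EReal.coe_le_coe_iff] at hz ⊢
        nlinarith
    · simp only
      nlinarith
  · exact exists_affineMinorant_of_separating hbot h1 h2 hb

/-- A proper convex lower semicontinuous function is the supremum of a sequence of affine
minorants. -/
lemma exists_seq_affineMinorants {f : ℝ → EReal} (hbot : ∀ z, f z ≠ ⊥) (hconv : IsConvexFn f)
    (hlsc : LowerSemicontinuous f) {x₀ t₀ : ℝ} (h₀ : f x₀ = (t₀ : EReal)) :
    ∃ p : ℕ → ℝ × ℝ, (∀ n, p n ∈ affineMinorants f) ∧
      ∀ x r : ℝ, (r : EReal) < f x → ∃ n, r < x * (p n).1 - (p n).2 := by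
  have : Nonempty (affineMinorants f) := by
    obtain ⟨p, hp, -⟩ := exists_affineMinorant_gt (x := x₀) (r := t₀ - 1) hbot hconv hlsc h₀
      (by rw [h₀, EReal.coe_lt_coe_iff]; linarith)
    exact ⟨p, hp⟩
  refine ⟨fun n => (TopologicalSpace.denseSeq (affineMinorants f) n : ℝ × ℝ),
    fun n => Subtype.prop _, fun x r hr => ?_⟩
  obtain ⟨p, hp, hpr⟩ := exists_affineMinorant_gt hbot hconv hlsc h₀ hr
  -- The strict inequality is open in the minorant, so a dense sequence of minorants meets it.
  have hopen : IsOpen {q : affineMinorants f | r < x * (q : ℝ × ℝ).1 - (q : ℝ × ℝ).2} :=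
    isOpen_lt continuous_const (by fun_prop)
  exact (TopologicalSpace.denseRange_denseSeq _).exists_mem_open hopen ⟨⟨p, hp⟩, hpr⟩

/-- Index of a maximal element among the first `n + 1` affine functions of a sequence. -/
noncomputable def argmaxIndex (p : ℕ → ℝ × ℝ) : ℕ → ℝ → ℕ
  | 0, _ => 0
  | n + 1, x =>
    if x * (p (argmaxIndex p n x)).1 - (p (argmaxIndex p n x)).2 < x * (p (n + 1)).1 - (p (n + 1)).2
    then n + 1 else argmaxIndex p n x

lemma argmaxIndex_le (p : ℕ → ℝ × ℝ) (n : ℕ) (x : ℝ) : argmaxIndex p n x ≤ n := by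
  induction n with
  | zero => simp [argmaxIndex]
  | succ n ih =>
    rw [argmaxIndex]
    split_ifs
    · exact le_rfl
    · omega

lemma measurable_argmaxIndex (p : ℕ → ℝ × ℝ) (n : ℕ) : Measurable (argmaxIndex p n) := by
  induction n with
  | zero => exact measurable_const
  | succ n ih =>
    have h1 : Measurable fun x => (p (argmaxIndex p n x)).1 :=
      (measurable_from_top (f := fun k => (p k).1)).comp ih
    have h2 : Measurable fun x => (p (argmaxIndex p n x)).2 :=
      (measurable_from_top (f := fun k => (p k).2)).comp ih
    refine Measurable.ite (measurableSet_lt ?_ ?_) measurable_const ih <;> fun_prop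

lemma monotone_argmaxIndex (p : ℕ → ℝ × ℝ) (x : ℝ) :
    Monotone fun n => x * (p (argmaxIndex p n x)).1 - (p (argmaxIndex p n x)).2 := by
  refine monotone_nat_of_le_succ fun n => ?_
  rw [argmaxIndex]
  split_ifs with h
  · exact h.le
  · exact le_rfl

lemma le_argmaxIndex (p : ℕ → ℝ × ℝ) (n : ℕ) (x : ℝ) :
    x * (p n).1 - (p n).2 ≤ x * (p (argmaxIndex p n x)).1 - (p (argmaxIndex p n x)).2 := by
  cases n with
  | zero => simp [argmaxIndex]
  | succ n =>
    rw [argmaxIndex]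
    split_ifs with h
    · exact le_rfl
    · exact not_lt.1 h

/-- Measurable selection of affine minorants increasing to `f` pointwise. -/
lemma exists_measurable_affineMinorants {f : ℝ → EReal} (hbot : ∀ z, f z ≠ ⊥)
    (hconv : IsConvexFn f) (hlsc : LowerSemicontinuous f) {x₀ t₀ : ℝ}
    (h₀ : f x₀ = (t₀ : EReal)) :
    ∃ y c : ℕ → ℝ → ℝ, (∀ n, Measurable (y n)) ∧ (∀ n, Measurable (c n)) ∧
      (∀ n, ∃ B, ∀ x, |y n x| ≤ B ∧ |c n x| ≤ B) ∧
      (∀ n x, (y n x, c n x) ∈ affineMinorants f) ∧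
      (∀ x, Monotone fun n => x * y n x - c n x) ∧
      ∀ x, Tendsto (fun n => ((x * y n x - c n x : ℝ) : EReal)) atTop (𝓝 (f x)) := by
  obtain ⟨p, hp, hsup⟩ := exists_seq_affineMinorants hbot hconv hlsc h₀
  refine ⟨fun n x => (p (argmaxIndex p n x)).1, fun n x => (p (argmaxIndex p n x)).2,
    fun n => (measurable_from_top (f := fun k => (p k).1)).comp (measurable_argmaxIndex p n),
    fun n => (measurable_from_top (f := fun k => (p k).2)).comp (measurable_argmaxIndex p n),
    -- At stage `n` only `n + 1` minorants compete, whence a bound uniform in `x`.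
    fun n => ⟨∑ k ∈ Finset.range (n + 1), (|(p k).1| + |(p k).2|), fun x => ?_⟩,
    fun n x => hp _, monotone_argmaxIndex p, fun x => ?_⟩
  · have h := Finset.single_le_sum (f := fun k => |(p k).1| + |(p k).2|)
      (fun k _ => by positivity)
      (Finset.mem_range.2 (Nat.lt_succ_of_le (argmaxIndex_le p n x)))
    have h1 := abs_nonneg (p (argmaxIndex p n x)).1
    have h2 := abs_nonneg (p (argmaxIndex p n x)).2
    constructor <;> linarith
  · refine tendsto_atTop_isLUB
      (fun m n h => EReal.coe_le_coe_iff.2 (monotone_argmaxIndex p x h)) ⟨?_, fun b hb => ?_⟩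
    · rintro _ ⟨n, rfl⟩
      exact hp _ x
    · refine EReal.le_of_forall_lt_iff_le.1 fun r hr => ?_
      by_contra! hlt
      obtain ⟨n, hn⟩ := hsup x r hlt
      have := hb ⟨n, rfl⟩
      have h3 := (EReal.coe_le_coe_iff.2 (hn.le.trans (le_argmaxIndex p n x))).trans this
      exact absurd hr (not_lt.2 h3)

/-! ### Slopes at infinity and conjugates -/

/-- Divide the minorant by `x` and let `x → ∞`. This makes the selected slopes admissible test
values. -/
lemma le_slopeAtTop {f : ℝ → EReal} {p : ℝ × ℝ} (hp : p ∈ affineMinorants f) :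
    (p.1 : EReal) ≤ slopeAtTop f := by
  have h1 : Tendsto (fun x : ℝ => ((p.1 - p.2 / x : ℝ) : EReal)) atTop (𝓝 (p.1 : EReal)) := by
    refine (continuous_coe_real_ereal.tendsto _).comp ?_
    simpa using tendsto_const_nhds.sub (tendsto_const_nhds.div_atTop (a := p.2) tendsto_id)
  rw [slopeAtTop, ← h1.limsup_eq]
  refine limsup_le_limsup ?_
  filter_upwards [eventually_gt_atTop 0] with x hx
  have e : ((p.1 - p.2 / x : ℝ) : EReal) = ((x * p.1 - p.2 : ℝ) : EReal) / (x : EReal) := by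
    rw [← EReal.coe_div]
    congr 1
    field_simp
  rw [e]
  exact EReal.div_le_div_right_of_nonneg (EReal.coe_nonneg.2 hx.le) (hp x)

/-- A minorant of `f` also minorizes `posRestrict f`. Thus the intercept bounds the conjugate, and
the supremum need not be attained. -/
lemma conjugate_posRestrict_le {f : ℝ → EReal} {p : ℝ × ℝ} (hp : p ∈ affineMinorants f) :
    conjugate (posRestrict f) p.1 ≤ (p.2 : EReal) := by
  refine iSup_le fun x => ?_
  have h : ((x * p.1 - p.2 : ℝ) : EReal) ≤ posRestrict f x := by
    rw [posRestrict]
    split_ifs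
    · exact hp x
    · exact le_top
  refine (EReal.sub_le_sub le_rfl h).trans ?_
  rw [← EReal.coe_sub]
  simp

/-- Fenchel–Young inequality. -/
lemma sub_le_conjugate_posRestrict (f : ℝ → EReal) {x : ℝ} (hx : 0 ≤ x) (y : ℝ) :
    ((x * y : ℝ) : EReal) - f x ≤ conjugate (posRestrict f) y := by
  have := le_iSup (fun x : ℝ => ((x * y : ℝ) : EReal) - posRestrict f x) x
  simpa [posRestrict, hx, conjugate] using this

lemma measurable_conjugate {f : ℝ → EReal} (hbot : ∀ z, f z ≠ ⊥) : Measurable (conjugate f) := by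
  refine LowerSemicontinuous.measurable (lowerSemicontinuous_iSup fun x => ?_)
  refine Continuous.lowerSemicontinuous ?_
  rcases eq_or_ne (f x) ⊤ with h | h
  · simp only [h, EReal.sub_top]
    exact continuous_const
  · lift f x to ℝ using ⟨h, hbot x⟩ with t
    simp only [← EReal.coe_sub]
    exact continuous_coe_real_ereal.comp (by fun_prop)

/-! ### Extended integrals -/

variable {Ω : Type*} [MeasurableSpace Ω]

lemma lintegral_ofReal_ne_top {ν : Measure Ω} {f : Ω → ℝ} (hf : Integrable f ν) :
    ∫⁻ ω, ENNReal.ofReal (f ω) ∂ν ≠ ∞ := by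
  refine ne_top_of_le_ne_top hf.2.ne (lintegral_mono fun ω => ?_)
  rw [Real.enorm_eq_ofReal_abs]
  exact ENNReal.ofReal_le_ofReal (le_abs_self _)

lemma extIntegral_coe {ν : Measure Ω} {f : Ω → ℝ} (hf : Integrable f ν) :
    extIntegral ν (fun ω => (f ω : EReal)) = ((∫ ω, f ω ∂ν : ℝ) : EReal) := by
  have h1 := lintegral_ofReal_ne_top hf
  have h2 : ∫⁻ ω, ENNReal.ofReal (-f ω) ∂ν ≠ ∞ := lintegral_ofReal_ne_top hf.neg
  rw [integral_eq_lintegral_pos_part_sub_lintegral_neg_part hf, EReal.coe_sub,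
    EReal.coe_ennreal_toReal h1, EReal.coe_ennreal_toReal h2]
  simp only [extIntegral, ← EReal.coe_neg, EReal.real_coe_toENNReal]

lemma extIntegral_mono {ν : Measure Ω} {f g : Ω → EReal} (h : ∀ᵐ ω ∂ν, f ω ≤ g ω) :
    extIntegral ν f ≤ extIntegral ν g := by
  refine EReal.sub_le_sub (EReal.coe_ennreal_le_coe_ennreal_iff.2 (lintegral_mono_ae ?_))
    (EReal.coe_ennreal_le_coe_ennreal_iff.2 (lintegral_mono_ae ?_))
  · filter_upwards [h] with ω hω using EReal.toENNReal_le_toENNReal hω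
  · filter_upwards [h] with ω hω using
      EReal.toENNReal_le_toENNReal (EReal.neg_le_neg_iff.2 hω)

lemma lintegral_neg_ne_top {ν : Measure Ω} {f : Ω → EReal} {l : Ω → ℝ} (hl : Integrable l ν)
    (h : ∀ᵐ ω ∂ν, (l ω : EReal) ≤ f ω) : ∫⁻ ω, (-f ω).toENNReal ∂ν ≠ ∞ := by
  refine ne_top_of_le_ne_top (lintegral_ofReal_ne_top hl.neg) (lintegral_mono_ae ?_)
  filter_upwards [h] with ω hω
  have := EReal.toENNReal_le_toENNReal (EReal.neg_le_neg_iff.2 hω)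
  rwa [← EReal.coe_neg, EReal.real_coe_toENNReal] at this

/-- A measurable function with an integrable lower bound and a finite integral is almost
everywhere a real integrable function. -/
lemma exists_integrable_of_extIntegral_ne_top {ν : Measure Ω} {f : Ω → EReal} {l : Ω → ℝ}
    (hf : Measurable f) (hl : Integrable l ν) (h : ∀ᵐ ω ∂ν, (l ω : EReal) ≤ f ω)
    (hne : extIntegral ν f ≠ ⊤) :
    ∃ g : Ω → ℝ, Integrable g ν ∧ (∀ᵐ ω ∂ν, f ω = (g ω : EReal)) ∧
      extIntegral ν f = ((∫ ω, g ω ∂ν : ℝ) : EReal) := by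
  have hneg := lintegral_neg_ne_top hl h
  have hpos : ∫⁻ ω, (f ω).toENNReal ∂ν ≠ ∞ := by
    intro htop
    apply hne
    rw [extIntegral, htop, ← ENNReal.coe_toNNReal hneg]
    rfl
  have hae : ∀ᵐ ω ∂ν, f ω = ((f ω).toReal : EReal) := by
    filter_upwards [h, ae_lt_top hf.ereal_toENNReal hpos] with ω h1 h2
    exact (EReal.coe_toReal (EReal.toENNReal_ne_top_iff.1 h2.ne)
      (ne_bot_of_le_ne_bot (EReal.coe_ne_bot _) h1)).symm
  have hint : Integrable (fun ω => (f ω).toReal) ν := by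
    refine ⟨hf.ereal_toReal.aestronglyMeasurable, ?_⟩
    have hle : ∫⁻ ω, ‖(f ω).toReal‖ₑ ∂ν ≤
        ∫⁻ ω, ((f ω).toENNReal + (-f ω).toENNReal) ∂ν := by
      refine lintegral_mono_ae ?_
      filter_upwards [hae] with ω hω
      rw [hω, EReal.toReal_coe, ← EReal.coe_neg, EReal.real_coe_toENNReal,
        EReal.real_coe_toENNReal, Real.enorm_eq_ofReal_abs]
      rcases abs_cases (f ω).toReal with ⟨h', -⟩ | ⟨h', -⟩ <;> rw [h']
      · exact le_self_add
      · exact le_add_self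
    refine hle.trans_lt ?_
    rw [lintegral_add_left hf.ereal_toENNReal]
    exact ENNReal.add_lt_top.2 ⟨hpos.lt_top, hneg.lt_top⟩
  refine ⟨_, hint, hae, ?_⟩
  rw [← extIntegral_coe hint]
  exact le_antisymm (extIntegral_mono (hae.mono fun ω h => h.le))
    (extIntegral_mono (hae.mono fun ω h => h.ge))

/-- Monotone convergence. -/
lemma tendsto_integral_extIntegral {ν : Measure Ω} {h : ℕ → Ω → ℝ} {f : Ω → EReal}
    (hi : ∀ n, Integrable (h n) ν) (hmono : ∀ᵐ ω ∂ν, Monotone fun n => h n ω)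
    (hlim : ∀ᵐ ω ∂ν, Tendsto (fun n => (h n ω : EReal)) atTop (𝓝 (f ω))) :
    Tendsto (fun n => ((∫ ω, h n ω ∂ν : ℝ) : EReal)) atTop (𝓝 (extIntegral ν f)) := by
  have hpos : Tendsto (fun n => ∫⁻ ω, ENNReal.ofReal (h n ω) ∂ν) atTop
      (𝓝 (∫⁻ ω, (f ω).toENNReal ∂ν)) := by
    refine lintegral_tendsto_of_tendsto_of_monotone (fun n => (hi n).aemeasurable.ennreal_ofReal)
      ?_ ?_
    · filter_upwards [hmono] with ω hω m n hmn using ENNReal.ofReal_le_ofReal (hω hmn)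
    · filter_upwards [hlim] with ω hω using (EReal.continuous_toENNReal.tendsto _).comp hω
  have hneg : Tendsto (fun n => ∫⁻ ω, ENNReal.ofReal (-h n ω) ∂ν) atTop
      (𝓝 (∫⁻ ω, (-f ω).toENNReal ∂ν)) := by
    refine lintegral_tendsto_of_tendsto_of_antitone
      (fun n => (hi n).neg.aemeasurable.ennreal_ofReal) ?_ (lintegral_ofReal_ne_top (hi 0).neg) ?_
    · filter_upwards [hmono] with ω hω m n hmn using
        ENNReal.ofReal_le_ofReal (neg_le_neg (hω hmn))
    · filter_upwards [hlim] with ω hω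
      have := (EReal.continuous_toENNReal.tendsto _).comp (((continuous_neg (G := EReal)).tendsto _).comp hω)
      exact this
  have hbound : ∫⁻ ω, (-f ω).toENNReal ∂ν ≠ ∞ := by
    refine lintegral_neg_ne_top (hi 0) ?_
    filter_upwards [hmono, hlim] with ω h1 h2
    exact ge_of_tendsto' h2 fun n => EReal.coe_le_coe_iff.2 (h1 (Nat.zero_le n))
  have key : Tendsto (fun n => ((∫⁻ ω, ENNReal.ofReal (h n ω) ∂ν : ℝ≥0∞) : EReal) +
      -((∫⁻ ω, ENNReal.ofReal (-h n ω) ∂ν : ℝ≥0∞) : EReal)) atTop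
      (𝓝 (extIntegral ν f)) := by
    -- The limit of the negative parts is finite, so the sum is not `⊤ + ⊥` and addition is
    -- continuous there.
    refine (EReal.continuousAt_add (p := (((∫⁻ ω, (f ω).toENNReal ∂ν : ℝ≥0∞) : EReal),
      -((∫⁻ ω, (-f ω).toENNReal ∂ν : ℝ≥0∞) : EReal))) (Or.inr ?_)
      (Or.inl (EReal.coe_ennreal_ne_bot _))).tendsto.comp
      (((continuous_coe_ennreal_ereal.tendsto _).comp hpos).prodMk_nhds
        (((continuous_neg (G := EReal)).tendsto _).comp
          ((continuous_coe_ennreal_ereal.tendsto _).comp hneg)))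
    simpa using hbound
  refine key.congr fun n => ?_
  rw [← extIntegral_coe (hi n)]
  simp only [extIntegral, ← EReal.coe_neg, EReal.real_coe_toENNReal]
  rfl

/-! ### Divergence of a nonnegative measure -/

lemma toJordanDecomposition_toSignedMeasure (P : Measure Ω) [IsFiniteMeasure P] :
    P.toSignedMeasure.toJordanDecomposition =
      ⟨P, 0, Measure.MutuallySingular.zero_right⟩ := by
  rw [← JordanDecomposition.toJordanDecomposition_toSignedMeasure
    ⟨P, 0, Measure.MutuallySingular.zero_right⟩]
  simp [JordanDecomposition.toSignedMeasure]

/-- The singular part is nonnegative, so the `φ'(-∞)` term is `0 * slopeAtBot φ = 0`. -/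
lemma divergence_toSignedMeasure (φ : ℝ → EReal) (ν P : Measure Ω) [IsFiniteMeasure P]
    [IsFiniteMeasure ν] :
    divergence φ ν P.toSignedMeasure =
      extIntegral ν (fun ω => φ (P.rnDeriv ν ω).toReal) +
        ((P.singularPart ν Set.univ : ℝ≥0∞) : EReal) * slopeAtTop φ := by
  have hs : P.toSignedMeasure.singularPart ν = (P.singularPart ν).toSignedMeasure := by
    simp [SignedMeasure.singularPart, toJordanDecomposition_toSignedMeasure,
      Measure.singularPart_zero]
  have hr : ∀ᵐ ω ∂ν, P.toSignedMeasure.rnDeriv ν ω = (P.rnDeriv ν ω).toReal := by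
    filter_upwards [Measure.rnDeriv_zero ν] with ω hω
    simp [SignedMeasure.rnDeriv, toJordanDecomposition_toSignedMeasure, hω]
  have hi : extIntegral ν (fun ω => φ (P.toSignedMeasure.rnDeriv ν ω)) =
      extIntegral ν (fun ω => φ (P.rnDeriv ν ω).toReal) :=
    le_antisymm (extIntegral_mono (hr.mono fun ω h => by rw [h]))
      (extIntegral_mono (hr.mono fun ω h => by rw [h]))
  rw [divergence, hs, toJordanDecomposition_toSignedMeasure, hi]
  simp

lemma integral_eq_rnDeriv_add_singularPart (ν P : Measure Ω) [IsFiniteMeasure P]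
    [IsFiniteMeasure ν] {g : Ω → ℝ} (hg : Integrable g P) :
    Integrable (fun ω => (P.rnDeriv ν ω).toReal * g ω) ν ∧ Integrable g (P.singularPart ν) ∧
      ∫ ω, g ω ∂P = ∫ ω, (P.rnDeriv ν ω).toReal * g ω ∂ν + ∫ ω, g ω ∂(P.singularPart ν) := by
  have hP := Measure.rnDeriv_add_singularPart P ν
  have h1 : Integrable g (ν.withDensity (P.rnDeriv ν)) :=
    hg.mono_measure (Measure.withDensity_rnDeriv_le P ν)
  have h2 : Integrable g (P.singularPart ν) := hg.mono_measure (Measure.singularPart_le P ν)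
  refine ⟨?_, h2, ?_⟩
  · have := (integrable_withDensity_iff_integrable_smul' (Measure.measurable_rnDeriv P ν)
      (Measure.rnDeriv_lt_top P ν)).1 h1
    simpa using this
  · conv_lhs => rw [← hP]
    rw [integral_add_measure h1 h2, integral_withDensity_eq_integral_toReal_smul
      (Measure.measurable_rnDeriv P ν) (Measure.rnDeriv_lt_top P ν)]
    simp

/-! ### Essential range and essential supremum -/

/-- A measure vanishing on the ideal does not charge the set where a function exceeds its
essential supremum. -/
lemma measure_lt_essSupIdeal {Ξ : Set (Set Ω)} {P : Measure Ω} (hP : ∀ A ∈ Ξ, P A = 0)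
    {g : Ω → ℝ} (hg : Measurable g) : ∀ᵐ ω ∂P, (g ω : EReal) ≤ essSupIdeal Ξ g := by
  have : P.map g {x | ¬ (x : EReal) ≤ essSupIdeal Ξ g} = 0 := by
    -- Each point outside the essential range has a neighbourhood with preimage in `Ξ`; on the line,
    -- locally null sets are null.
    refine measure_null_of_locally_null _ fun x hx => ?_
    have hx' : x ∉ essRange Ξ g := fun h => hx (le_biSup (fun x : ℝ => (x : EReal)) h)
    simp only [essRange, Set.mem_ofPred_eq, not_forall, not_not] at hx'
    obtain ⟨ε, hε, h⟩ := hx'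
    refine ⟨_, mem_nhdsWithin_of_mem_nhds (Ioo_mem_nhds (sub_lt_self x hε) (lt_add_of_pos_right x hε)), ?_⟩
    rw [Measure.map_apply hg measurableSet_Ioo]
    exact hP _ h
  exact ae_of_ae_map hg.aemeasurable this

omit [MeasurableSpace Ω] in
lemma essSupIdeal_le {Ξ : Set (Set Ω)} (hΞ : ∅ ∈ Ξ) {g : Ω → ℝ} {a : EReal}
    (h : ∀ ω, (g ω : EReal) ≤ a) : essSupIdeal Ξ g ≤ a := by
  refine iSup₂_le fun x hx => ?_
  by_contra! hlt
  obtain ⟨y, hay, hyx⟩ := EReal.lt_iff_exists_real_btwn.1 hlt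
  rw [EReal.coe_lt_coe_iff] at hyx
  refine hx (x - y) (by linarith) ?_
  convert hΞ
  ext ω
  simp only [Set.mem_preimage, Set.mem_Ioo, Set.mem_empty_iff_false, iff_false, not_and]
  intro h1
  have h2 := EReal.coe_lt_coe_iff.1 ((h ω).trans_lt hay)
  linarith

omit [MeasurableSpace Ω] in
lemma isBounded_essRange {Ξ : Set (Set Ω)} (hΞ : ∅ ∈ Ξ) {g : Ω → ℝ} {B : ℝ}
    (h : ∀ ω, |g ω| ≤ B) : Bornology.IsBounded (essRange Ξ g) := by
  refine (Metric.isBounded_Icc (-B) B).subset fun x hx => ?_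
  by_contra hnot
  obtain ⟨ε, hε, hd⟩ := Metric.isOpen_iff.1 (isClosed_Icc (a := -B) (b := B)).isOpen_compl x hnot
  refine hx ε hε ?_
  convert hΞ
  ext ω
  simp only [Set.mem_preimage, Set.mem_empty_iff_false, iff_false]
  intro h1
  rw [← Real.ball_eq_Ioo] at h1
  exact hd h1 (abs_le.1 (h ω))

/-! ### The two inequalities -/

/-- Every admissible shift of a test function yields a lower bound of the divergence. -/
lemma le_divergence_toSignedMeasure {φ : ℝ → EReal} (hbot : ∀ x, φ x ≠ ⊥) (hφ_one : φ 1 = 0)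
    {p : ℝ × ℝ} (hp : p ∈ affineMinorants φ)
    {ν P : Measure Ω} [IsFiniteMeasure ν] [IsProbabilityMeasure P] {g : Ω → ℝ} {t : ℝ}
    (hg : Measurable g) (hgν : Integrable g ν) (hgP : Integrable g P)
    (hle : ∀ᵐ ω ∂P, ((g ω + t : ℝ) : EReal) ≤ slopeAtTop φ) :
    ((∫ ω, g ω ∂P : ℝ) : EReal) -
        (extIntegral ν (fun ω => conjugate (posRestrict φ) (g ω + t)) - (t : EReal)) ≤
      divergence φ ν P.toSignedMeasure := by
  have hposbot : ∀ z, posRestrict φ z ≠ ⊥ := fun z => by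
    rw [posRestrict]; split_ifs <;> simp [hbot]
  set G : Ω → EReal := fun ω => conjugate (posRestrict φ) (g ω + t) with hG
  have hGm : Measurable G := (measurable_conjugate hposbot).comp (hg.add_const t)
  have hl : Integrable (fun ω => g ω + t) ν := hgν.add (integrable_const t)
  -- Fenchel–Young at `x = 1`, where `φ` vanishes, gives an integrable lower bound.
  have hGl : ∀ᵐ ω ∂ν, ((g ω + t : ℝ) : EReal) ≤ G ω := ae_of_all _ fun ω => by
    have := sub_le_conjugate_posRestrict φ zero_le_one (g ω + t)
    simpa [hφ_one] using this
  by_cases htop : extIntegral ν G = ⊤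
  · simp [htop]
  obtain ⟨H, hH, hGH, hint⟩ := exists_integrable_of_extIntegral_ne_top hGm hl hGl htop
  have hgt : Integrable (fun ω => g ω + t) P := hgP.add (integrable_const t)
  obtain ⟨hi1, hi2, hdec⟩ := integral_eq_rnDeriv_add_singularPart ν P hgt
  have hlow : ((∫ ω, (P.rnDeriv ν ω).toReal * (g ω + t) ∂ν - ∫ ω, H ω ∂ν : ℝ) : EReal) ≤
      extIntegral ν (fun ω => φ (P.rnDeriv ν ω).toReal) := by
    rw [← integral_sub hi1 hH]
    refine (extIntegral_coe (hi1.sub hH)).ge.trans ?_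
    refine extIntegral_mono ?_
    filter_upwards [hGH] with ω hω
    have h := sub_le_conjugate_posRestrict φ (x := (P.rnDeriv ν ω).toReal) ENNReal.toReal_nonneg
      (g ω + t)
    change _ ≤ G ω at h
    rw [hω] at h
    rcases eq_or_ne (φ (P.rnDeriv ν ω).toReal) ⊤ with h' | h'
    · rw [h']; exact le_top
    · lift φ (P.rnDeriv ν ω).toReal to ℝ using ⟨h', hbot _⟩ with s
      rw [← EReal.coe_sub, EReal.coe_le_coe_iff] at h
      simp only [Pi.sub_apply]
      rw [EReal.coe_le_coe_iff]
      linarith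
  have hsing : ((∫ ω, (g ω + t) ∂(P.singularPart ν) : ℝ) : EReal) ≤
      ((P.singularPart ν Set.univ : ℝ≥0∞) : EReal) * slopeAtTop φ := by
    have hle' : ∀ᵐ ω ∂(P.singularPart ν), ((g ω + t : ℝ) : EReal) ≤ slopeAtTop φ :=
      (Measure.absolutelyContinuous_of_le (Measure.singularPart_le P ν)).ae_le hle
    have hbot' : slopeAtTop φ ≠ ⊥ :=
      ne_bot_of_le_ne_bot (EReal.coe_ne_bot _) (le_slopeAtTop hp)
    -- Zero mass is treated apart because of `0 * ⊤ = 0`.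
    rcases eq_or_ne (P.singularPart ν) 0 with h0 | h0
    · simp [h0]
    rcases eq_or_ne (slopeAtTop φ) ⊤ with h' | h'
    · rw [h', EReal.mul_top_of_pos]
      · exact le_top
      · simpa using h0
    · lift slopeAtTop φ to ℝ using ⟨h', hbot'⟩ with s
      rw [← EReal.coe_ennreal_toReal (measure_ne_top _ _), ← EReal.coe_mul,
        EReal.coe_le_coe_iff]
      refine (integral_mono_ae hi2 (integrable_const s) ?_).trans_eq (by simp [Measure.real])
      filter_upwards [hle'] with ω hω using EReal.coe_le_coe_iff.1 hω
  rw [divergence_toSignedMeasure, hint]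
  refine le_trans (le_of_eq ?_) (add_le_add hlow hsing)
  rw [← EReal.coe_sub, ← EReal.coe_sub, ← EReal.coe_add]
  congr 1
  have : ∫ ω, (g ω + t) ∂P = ∫ ω, g ω ∂P + t := by
    rw [integral_add hgP (integrable_const t)]; simp
  linarith

/-- The divergence is approximated from below by bounded measurable test functions bounded by
`φ'(∞)`. -/
lemma divergence_toSignedMeasure_le {φ : ℝ → EReal} (hbot : ∀ x, φ x ≠ ⊥)
    (hconv : IsConvexFn φ) (hlsc : LowerSemicontinuous φ) (hφ_one : φ 1 = 0)
    {ν P : Measure Ω} [IsFiniteMeasure ν] [IsProbabilityMeasure P] {S : EReal}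
    (hS : ∀ g : Ω → ℝ, Measurable g → (∃ B, ∀ ω, |g ω| ≤ B) →
      (∀ ω, (g ω : EReal) ≤ slopeAtTop φ) →
      ((∫ ω, g ω ∂P : ℝ) : EReal) - extIntegral ν (fun ω => conjugate (posRestrict φ) (g ω)) ≤ S) :
    divergence φ ν P.toSignedMeasure ≤ S := by
  obtain ⟨y, c, hy, hc, hB, hmin, hmono, hlim⟩ :=
    exists_measurable_affineMinorants hbot hconv hlsc (x₀ := 1) (t₀ := 0) (by simpa using hφ_one)
  set f : Ω → ℝ := fun ω => (P.rnDeriv ν ω).toReal with hf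
  have hfm : Measurable f := (Measure.measurable_rnDeriv P ν).ennreal_toReal
  have hfi : Integrable f ν := Measure.integrable_toReal_rnDeriv
  obtain ⟨N, hN, hN1, hN2⟩ := Measure.mutuallySingular_singularPart P ν
  set m : ℝ := (P.singularPart ν).real Set.univ with hm
  have hyi : ∀ n, Integrable (fun ω => f ω * y n (f ω)) ν := fun n => by
    obtain ⟨B, hB⟩ := hB n
    exact hfi.mul_bdd (c := B) ((hy n).comp hfm).aestronglyMeasurable
      (ae_of_all _ fun ω => (hB _).1)
  have hci : ∀ n, Integrable (fun ω => c n (f ω)) ν := fun n => by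
    obtain ⟨B, hB⟩ := hB n
    exact Integrable.of_bound ((hc n).comp hfm).aestronglyMeasurable B
      (ae_of_all _ fun ω => (hB _).2)
  -- The real `s` stands in for `φ'(∞)`, which may be `⊤`.
  have key : ∀ (n : ℕ) (s : ℝ), (s : EReal) ≤ slopeAtTop φ →
      ((∫ ω, (f ω * y n (f ω) - c n (f ω)) ∂ν + m * s : ℝ) : EReal) ≤ S := by
    intro n s hs
    classical
    obtain ⟨B, hB⟩ := hB n
    set g : Ω → ℝ := fun ω => if ω ∈ N then y n (f ω) else s with hg
    have hgm : Measurable g := Measurable.ite hN ((hy n).comp hfm) measurable_const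
    have hgB : ∀ ω, |g ω| ≤ B + |s| := fun ω => by
      simp only [hg]
      have h1 := hB (f ω)
      have h2 := (abs_nonneg _).trans h1.1
      have h3 := abs_nonneg s
      split_ifs <;> linarith [h1.1]
    have hgN : ∀ᵐ ω ∂ν, g ω = y n (f ω) := by
      filter_upwards [compl_mem_ae_iff.2 hN2] with ω hω
      simp only [hg, if_pos (Set.notMem_compl_iff.1 hω)]
    have hgs : ∀ᵐ ω ∂(P.singularPart ν), g ω = s := by
      filter_upwards [compl_mem_ae_iff.2 hN1] with ω hω
      simp only [hg, if_neg hω]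
    have hgP : Integrable g P := Integrable.of_bound hgm.aestronglyMeasurable (B + |s|)
      (ae_of_all _ hgB)
    have hconj : extIntegral ν (fun ω => conjugate (posRestrict φ) (g ω)) ≤
        ((∫ ω, c n (f ω) ∂ν : ℝ) : EReal) := by
      rw [← extIntegral_coe (hci n)]
      refine extIntegral_mono ?_
      filter_upwards [hgN] with ω hω
      rw [hω]
      exact conjugate_posRestrict_le (hmin n (f ω))
    have hint : ∫ ω, g ω ∂P = ∫ ω, f ω * y n (f ω) ∂ν + m * s := by
      rw [(integral_eq_rnDeriv_add_singularPart ν P hgP).2.2]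
      congr 1
      · refine integral_congr_ae ?_
        filter_upwards [hgN] with ω hω
        rw [hω]
      · rw [integral_congr_ae hgs]
        simp [hm]
    refine le_trans ?_ ((EReal.sub_le_sub le_rfl hconj).trans
      (hS g hgm ⟨_, hgB⟩ fun ω => ?_))
    · rw [← EReal.coe_sub, EReal.coe_le_coe_iff, hint, integral_sub (hyi n) (hci n)]
      linarith
    · simp only [hg]
      split_ifs
      · exact le_slopeAtTop (hmin n (f ω))
      · exact hs
  have hF : Tendsto (fun n => ((∫ ω, (f ω * y n (f ω) - c n (f ω)) ∂ν : ℝ) : EReal)) atTop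
      (𝓝 (extIntegral ν (fun ω => φ (f ω)))) :=
    tendsto_integral_extIntegral (fun n => (hyi n).sub (hci n))
      (ae_of_all _ fun ω => hmono (f ω)) (ae_of_all _ fun ω => hlim (f ω))
  have key' : ∀ s : ℝ, (s : EReal) ≤ slopeAtTop φ →
      extIntegral ν (fun ω => φ (f ω)) + ((m * s : ℝ) : EReal) ≤ S := by
    intro s hs
    refine le_of_tendsto' ((EReal.continuousAt_add (p := (extIntegral ν (fun ω => φ (f ω)),
      ((m * s : ℝ) : EReal))) (Or.inr (EReal.coe_ne_bot _))
      (Or.inr (EReal.coe_ne_top _))).tendsto.comp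
      (hF.prodMk_nhds tendsto_const_nhds)) fun n => ?_
    simpa only [EReal.coe_add, Function.comp_apply] using key n s hs
  have hFbot : extIntegral ν (fun ω => φ (f ω)) ≠ ⊥ := by
    refine ne_bot_of_le_ne_bot (EReal.coe_ne_bot _) (Monotone.ge_of_tendsto ?_ hF 0)
    intro i j hij
    exact EReal.coe_le_coe_iff.2 (integral_mono ((hyi i).sub (hci i)) ((hyi j).sub (hci j))
      fun ω => hmono (f ω) hij)
  rw [divergence_toSignedMeasure, ← EReal.coe_ennreal_toReal (measure_ne_top _ _)]
  change extIntegral ν (fun ω => φ (f ω)) + (m : EReal) * slopeAtTop φ ≤ S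
  have hbot' : slopeAtTop φ ≠ ⊥ :=
    ne_bot_of_le_ne_bot (EReal.coe_ne_bot _) (le_slopeAtTop (hmin 0 0))
  rcases eq_or_ne (slopeAtTop φ) ⊤ with h' | h'
  · have hm0 : 0 ≤ m := measureReal_nonneg
    rcases hm0.eq_or_lt with h0 | h0
    · have := key' 0 (by simp [h'])
      rw [← h0] at this ⊢
      simpa using this
    · have hStop : S = ⊤ := by
        refine EReal.eq_top_iff_forall_lt S |>.2 fun r => ?_
        set E := extIntegral ν (fun ω => φ (f ω)) with hE
        obtain ⟨e, he⟩ : ∃ e : ℝ, (e : EReal) ≤ E := by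
          rcases eq_or_ne E ⊤ with h | h
          · exact ⟨0, h ▸ le_top⟩
          · exact ⟨E.toReal, (EReal.coe_toReal h hFbot).le⟩
        -- This `s` makes `e + m * s = r + 1`, which exceeds the arbitrary real `r`.
        have := key' ((r + 1 - e) / m) (by simp [h'])
        refine lt_of_lt_of_le ?_ ((add_le_add he le_rfl).trans this)
        rw [← EReal.coe_add, EReal.coe_lt_coe_iff, mul_div_cancel₀ _ h0.ne']
        linarith
      rw [hStop]
      exact le_top
  · have := key' (slopeAtTop φ).toReal (EReal.coe_toReal h' hbot').le
    rwa [EReal.coe_mul, EReal.coe_toReal h' hbot'] at this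

/-- Only `a` has to be finite. This turns a bound on `a - ⨅ …` into a bound for each admissible
shift, the empty infimum included. -/
lemma coe_sub_le_comm (a : ℝ) {b c : EReal} : (a : EReal) - b ≤ c ↔ (a : EReal) - c ≤ b := by
  induction b with
  | bot => induction c <;> simp [← EReal.coe_sub]
  | top => simp
  | coe b =>
    induction c with
    | bot => simp [← EReal.coe_sub]
    | top => simp
    | coe c => simp only [← EReal.coe_sub, EReal.coe_le_coe_iff, sub_le_comm]

/-! ### Variational formula and lower semicontinuity -/

lemma exists_eq_toSignedMeasure {μ : SignedMeasure Ω} (hμ : μ ∈ probMeasures Ω) :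
    ∃ P : Measure Ω, ∃ _ : IsProbabilityMeasure P, μ = P.toSignedMeasure := by
  have h0 : VectorMeasure.restrict 0 Set.univ ≤ VectorMeasure.restrict μ Set.univ :=
    (VectorMeasure.le_restrict_univ_iff_le _ _).2 hμ.1
  refine ⟨μ.toMeasureOfZeroLE Set.univ MeasurableSet.univ h0, ⟨?_⟩,
    (SignedMeasure.toMeasureOfZeroLE_toSignedMeasure μ h0).symm⟩
  rw [SignedMeasure.toMeasureOfZeroLE_apply _ _ _ MeasurableSet.univ]
  have := hμ.2
  simp only [Set.univ_inter, this]
  rfl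

lemma empty_mem_nullIdeal (X : Submodule ℝ (SignedMeasure Ω)) : ∅ ∈ nullIdeal X :=
  ⟨MeasurableSet.empty, fun _ _ => measure_empty⟩

lemma pairing_indicator_one (μ : SignedMeasure Ω) {A : Set Ω} (hA : MeasurableSet A) :
    pairing μ (A.indicator fun _ => 1) = μ A := by
  have : IsFiniteMeasure (VectorMeasure.restrict μ A).variation := by
    rw [← SignedMeasure.totalVariation_eq_variation, SignedMeasure.totalVariation]
    infer_instance
  rw [pairing, VectorMeasure.integral_indicator hA, VectorMeasure.integral_const]
  simp [VectorMeasure.restrict_apply, hA]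

namespace IsDecomposable

variable {X : Submodule ℝ (SignedMeasure Ω)} {Y : Submodule ℝ (Ω → ℝ)} {ν : Measure Ω}

lemma mem_of_abs_le [IsFiniteMeasure ν] (hXY : IsDecomposable X Y ν) {g : Ω → ℝ}
    (hg : Measurable g) {B : ℝ} (hB : ∀ ω, |g ω| ≤ B) : g ∈ Y :=
  hXY.mem_of_bounded g hg (isBounded_essRange (empty_mem_nullIdeal X) hB)

/-- The pairing with a fixed test function, as a linear form. -/
noncomputable def pairingForm [IsFiniteMeasure ν] (hXY : IsDecomposable X Y ν) {g : Ω → ℝ}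
    (hg : g ∈ Y) : X →ₗ[ℝ] ℝ where
  toFun μ := pairing (μ : SignedMeasure Ω) g
  map_add' μ₁ μ₂ := VectorMeasure.integral_add_vectorMeasure
    (hXY.integrable _ μ₁.2 g hg) (hXY.integrable _ μ₂.2 g hg)
  map_smul' r _ := VectorMeasure.integral_smul_vectorMeasure g r

lemma continuous_pairing [IsFiniteMeasure ν] (hXY : IsDecomposable X Y ν) {τ : TopologicalSpace X}
    (hτ : IsCompatibleTopology X Y τ) {g : Ω → ℝ} (hg : g ∈ Y) :
    Continuous fun μ : X => pairing (μ : SignedMeasure Ω) g :=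
  (hτ.continuous_iff (hXY.pairingForm hg)).2 ⟨g, hg, fun _ => rfl⟩

lemma continuous_apply [IsFiniteMeasure ν] (hXY : IsDecomposable X Y ν) {τ : TopologicalSpace X}
    (hτ : IsCompatibleTopology X Y τ) {A : Set Ω} (hA : MeasurableSet A) :
    Continuous fun μ : X => (μ : SignedMeasure Ω) A := by
  have hg : A.indicator (fun _ => (1 : ℝ)) ∈ Y :=
    hXY.mem_of_abs_le (B := 1) (measurable_const.indicator hA) fun ω => by
      by_cases h : ω ∈ A <;> simp [h]
  simpa only [pairing_indicator_one _ hA] using hXY.continuous_pairing hτ hg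

lemma isClosed_probMeasures [IsFiniteMeasure ν] (hXY : IsDecomposable X Y ν)
    {τ : TopologicalSpace X} (hτ : IsCompatibleTopology X Y τ) :
    IsClosed {μ : X | (μ : SignedMeasure Ω) ∈ probMeasures Ω} := by
  have h : {μ : X | (μ : SignedMeasure Ω) ∈ probMeasures Ω} =
      (⋂ (A : Set Ω) (_ : MeasurableSet A), {μ : X | 0 ≤ (μ : SignedMeasure Ω) A}) ∩
        {μ : X | (μ : SignedMeasure Ω) Set.univ = 1} := by
    ext μ
    simp [probMeasures, VectorMeasure.le_iff]
  rw [h]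
  refine IsClosed.inter (isClosed_biInter fun A hA => ?_) ?_
  · exact isClosed_le continuous_const (hXY.continuous_apply hτ hA)
  · exact isClosed_eq (hXY.continuous_apply hτ MeasurableSet.univ) continuous_const

lemma divergence_eq_iSup [IsProbabilityMeasure ν] (hXY : IsDecomposable X Y ν)
    {φ : ℝ → EReal} (hbot : ∀ x, φ x ≠ ⊥) (hconv : IsConvexFn φ)
    (hlsc : LowerSemicontinuous φ) (hφ_one : φ 1 = 0) {μ : SignedMeasure Ω} (hμX : μ ∈ X)
    (hμ : μ ∈ probMeasures Ω) :
    divergence φ ν μ = ⨆ g ∈ Y, ((pairing μ g : ℝ) : EReal) -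
      ⨅ (t : ℝ) (_ : (t : EReal) + essSupIdeal (nullIdeal X) g ≤ slopeAtTop φ),
        (extIntegral ν (fun ω => conjugate (posRestrict φ) (g ω + t)) - (t : EReal)) := by
  obtain ⟨P, hP, rfl⟩ := exists_eq_toSignedMeasure hμ
  have hnull : ∀ A ∈ nullIdeal X, P A = 0 := fun A hA => by
    simpa using hA.2 _ hμX
  have hpair : ∀ g : Ω → ℝ, pairing P.toSignedMeasure g = ∫ ω, g ω ∂P := fun g =>
    VectorMeasure.integral_toSignedMeasure
  -- Any minorant will do: it shows that `φ'(∞)` is not `⊥`.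
  obtain ⟨p, hp, -⟩ := exists_affineMinorant_gt (x₀ := 1) (t₀ := 0) (x := 1) (r := -1) hbot hconv
    hlsc (by simpa using hφ_one)
    (by rw [hφ_one, ← EReal.coe_zero, EReal.coe_lt_coe_iff]; norm_num)
  refine le_antisymm (divergence_toSignedMeasure_le hbot hconv hlsc hφ_one ?_)
    (iSup₂_le fun g hg => ?_)
  · rintro g hg ⟨B, hB⟩ hle
    refine le_iSup₂_of_le g (hXY.mem_of_abs_le hg hB) ?_
    rw [hpair]
    refine EReal.sub_le_sub le_rfl (iInf₂_le_of_le 0 ?_ ?_)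
    · simpa using essSupIdeal_le (empty_mem_nullIdeal X) hle
    · simp
  · have hgν : Integrable g ν := by
      simpa [VectorMeasure.Integrable] using hXY.integrable _ hXY.mem g hg
    have hgP : Integrable g P := by
      simpa [VectorMeasure.Integrable] using hXY.integrable _ hμX g hg
    rw [hpair]
    have hstep : ∀ t : ℝ, (t : EReal) + essSupIdeal (nullIdeal X) g ≤ slopeAtTop φ →
        ((∫ ω, g ω ∂P : ℝ) : EReal) -
          (extIntegral ν (fun ω => conjugate (posRestrict φ) (g ω + t)) - (t : EReal)) ≤
        divergence φ ν P.toSignedMeasure := by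
      intro t ht
      refine le_divergence_toSignedMeasure hbot hφ_one hp (hXY.measurable g hg) hgν hgP ?_
      filter_upwards [measure_lt_essSupIdeal hnull (hXY.measurable g hg)] with ω hω
      rw [add_comm, EReal.coe_add]
      exact (add_le_add le_rfl hω).trans ht
    exact (coe_sub_le_comm _).1 (le_iInf₂ fun t ht => (coe_sub_le_comm _).1 (hstep t ht))

lemma lowerSemicontinuous_probDivergence [IsProbabilityMeasure ν] (hXY : IsDecomposable X Y ν)
    {φ : ℝ → EReal} (hbot : ∀ x, φ x ≠ ⊥) (hconv : IsConvexFn φ)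
    (hlsc : LowerSemicontinuous φ) (hφ_one : φ 1 = 0)
    {τ : TopologicalSpace X} (hτ : IsCompatibleTopology X Y τ) :
    LowerSemicontinuous fun μ : X => probDivergence φ ν (μ : SignedMeasure Ω) := by
  set G : X → EReal := fun μ => ⨆ g ∈ Y, ((pairing (μ : SignedMeasure Ω) g : ℝ) : EReal) -
      ⨅ (t : ℝ) (_ : (t : EReal) + essSupIdeal (nullIdeal X) g ≤ slopeAtTop φ),
        (extIntegral ν (fun ω => conjugate (posRestrict φ) (g ω + t)) - (t : EReal)) with hG
  have hGlsc : LowerSemicontinuous G := by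
    refine lowerSemicontinuous_biSup fun g hg => Continuous.lowerSemicontinuous ?_
    -- The infimum does not depend on `μ`: each term is a continuous form minus a constant of
    -- `EReal`.
    have hc := hXY.continuous_pairing hτ hg
    generalize (⨅ (t : ℝ) (_ : (t : EReal) + essSupIdeal (nullIdeal X) g ≤ slopeAtTop φ),
        (extIntegral ν (fun ω => conjugate (posRestrict φ) (g ω + t)) - (t : EReal))) = a
    induction a with
    | bot => simpa using continuous_const
    | top => simpa using continuous_const
    | coe a =>
      simp only [← EReal.coe_sub]
      exact continuous_coe_real_ereal.comp (hc.sub continuous_const)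
  refine lowerSemicontinuous_iff_isClosed_preimage.2 fun b => ?_
  -- Below level `⊤`, sublevel sets contain only probability measures, where the formula applies.
  rcases eq_or_ne b ⊤ with rfl | hb
  · simp
  · have hset : (fun μ : X => probDivergence φ ν (μ : SignedMeasure Ω)) ⁻¹' Set.Iic b =
        {μ : X | (μ : SignedMeasure Ω) ∈ probMeasures Ω} ∩ G ⁻¹' Set.Iic b := by
      ext μ
      by_cases h : (μ : SignedMeasure Ω) ∈ probMeasures Ω
      · simp only [Set.mem_preimage, Set.mem_Iic, Set.mem_inter_iff, probDivergence, if_pos h]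
        rw [hXY.divergence_eq_iSup hbot hconv hlsc hφ_one μ.2 h]
        simp [hG, h]
      · simp [probDivergence, h, hb]
    rw [hset]
    exact (hXY.isClosed_probMeasures hτ).inter (hGlsc.isClosed_preimage b)

end IsDecomposable

end PhiDivergence

theorem mainTheorem1 {Ω : Type*} [MeasurableSpace Ω]
    (φ : ℝ → EReal) (hφ_ne_bot : ∀ x, φ x ≠ ⊥) (hφ_convex : PhiDivergence.IsConvexFn φ)
    (hφ_lsc : LowerSemicontinuous φ) (hφ_one : φ 1 = 0) (hφ_dom : ∀ᶠ x in 𝓝 (1 : ℝ), φ x ≠ ⊤)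
    (X : Submodule ℝ (SignedMeasure Ω)) (Y : Submodule ℝ (Ω → ℝ))
    (ν : Measure Ω) [IsProbabilityMeasure ν] (hXY : PhiDivergence.IsDecomposable X Y ν) :
    (∀ τ : TopologicalSpace X, PhiDivergence.IsCompatibleTopology X Y τ →
      LowerSemicontinuous
        (fun μ : X => PhiDivergence.probDivergence φ ν (μ : SignedMeasure Ω))) ∧
    (∀ μ ∈ X, μ ∈ PhiDivergence.probMeasures Ω →
      PhiDivergence.divergence φ ν μ =
        ⨆ g ∈ Y, ((PhiDivergence.pairing μ g : ℝ) : EReal) -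
          ⨅ (t : ℝ) (_ : (t : EReal) + PhiDivergence.essSupIdeal (PhiDivergence.nullIdeal X) g
              ≤ PhiDivergence.slopeAtTop φ),
            (PhiDivergence.extIntegral ν
              (fun ω => PhiDivergence.conjugate (PhiDivergence.posRestrict φ) (g ω + t))
                - (t : EReal))) := by
  refine ⟨fun τ hτ => ?_, fun μ hμX hμ => ?_⟩
  · exact hXY.lowerSemicontinuous_probDivergence hφ_ne_bot hφ_convex hφ_lsc hφ_one hτ
  · exact hXY.divergence_eq_iSup hφ_ne_bot hφ_convex hφ_lsc hφ_one hμX hμ
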